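/- For $A\in\mathbb R^{n\times n}$, $B_1\in\mathbb R^{n\times m_1}$, $B_2\in\mathbb R^{n\times m_2}$ let $$\mathcal S=\mathcal S(A,B_1,B_2)=\{(K,L)\in\mathbb R^{m_1\times n}\times\mathbb R^{m_2\times n}:\ \rho(A-B_1K-B_2L)<1\},$$ where $\rho$ denotes the spectral radius (the largest modulus of a complex eigenvalue). The pair $(A,[B_1,B_2])$ is called stabilizable if $\rho(A-[B_1,B_2]F)<1$ for some $F\in\mathbb R^{(m_1+m_2)\times n}$. (i) For all $n,m_1,m_2$ and all $A,B_1,B_2$, the set $\mathcal S$ is open in $\mathbb R^{m_1\times n}\times\mathbb R^{m_2\times n}$. (ii) If $(A,[B_1,B_2])$ is stabilizable, then $\mathcal S$ is contractible; in particular, it is path-connected and simply connected. (iii) $\mathcal S$ is in general not convex: for all $n\ge 2$ and $m_1,m_2\ge 1$ there are $A,B_1,B_2$ of these sizes with $(A,[B_1,B_2])$ stabilizable such that $\mathcal S(A,B_1,B_2)$ is not convex. -/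

import Mathlib

/-- A real square matrix is Schur if its (complex) spectral radius is less than one. -/
def IsSchur {n : ℕ} (M : Matrix (Fin n) (Fin n) ℝ) : Prop :=
  spectralRadius ℂ (M.map (fun x : ℝ => (x : ℂ))) < 1

/-- A pair `(A, B)` is stabilizable if `A - B K` is Schur for some real matrix `K`. -/
def IsStabilizable {n : ℕ} {ι : Type*} [Fintype ι]
    (A : Matrix (Fin n) (Fin n) ℝ) (B : Matrix (Fin n) ι ℝ) : Prop :=
  ∃ K : Matrix ι (Fin n) ℝ, IsSchur (A - B * K)

/-- The set of jointly stabilizing feedback gains `(K, L)`. -/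
def stabilizingPairs {n m₁ m₂ : ℕ} (A : Matrix (Fin n) (Fin n) ℝ)
    (B₁ : Matrix (Fin n) (Fin m₁) ℝ) (B₂ : Matrix (Fin n) (Fin m₂) ℝ) :
    Set (Matrix (Fin m₁) (Fin n) ℝ × Matrix (Fin m₂) (Fin n) ℝ) :=
  {p | IsSchur (A - B₁ * p.1 - B₂ * p.2)}

/-! By Gelfand's formula, spectral radius below one means that some positive power has norm below
one, an open condition. For contractibility, put `M = A - B₁ K - B₂ L`. It is Schur iff some `P ≻ 0`
satisfies `P - M P Mᵀ ≻ 0`; in the variables `P`, `Y₁ = K P`, `Y₂ = L P` a Schur complement turns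
this into a linear matrix inequality, with convex solution set. The map `(P, Y₁, Y₂) ↦ (Y₁ P⁻¹, Y₂
P⁻¹)` onto the stabilizing gains has a continuous section, taking `P` from the Stein equation `P - M
P Mᵀ = 1`. So the gains form a retract of a convex set. Convexity fails because the midpoint of two
nilpotent closed loops can have eigenvalue 1. -/

open Matrix Filter Topology
open scoped Kronecker

/-! ### Spectral radius and norms of powers -/

section SpectralRadius

variable {𝒜 : Type*} [NormedRing 𝒜] [NormedAlgebra ℂ 𝒜] [CompleteSpace 𝒜]

theorem exists_eventually_norm_pow_le_of_spectralRadius_lt_one {a : 𝒜}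
    (ha : spectralRadius ℂ a < 1) :
    ∃ r : ℝ, 0 ≤ r ∧ r < 1 ∧ ∀ᶠ k : ℕ in atTop, ‖a ^ k‖ ≤ r ^ k := by
  obtain ⟨r, hr, hr1⟩ := ENNReal.lt_iff_exists_nnreal_btwn.1 ha
  refine ⟨r, r.2, by exact_mod_cast hr1, ?_⟩
  have h := (spectrum.pow_nnnorm_pow_one_div_tendsto_nhds_spectralRadius a).eventually_lt_const hr
  filter_upwards [h, eventually_gt_atTop 0] with k hk hk0
  have hk' : (0 : ℝ) < k := by exact_mod_cast hk0
  rw [one_div, ENNReal.rpow_inv_lt_iff hk', ENNReal.rpow_natCast] at hk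
  have : ‖a ^ k‖₊ < r ^ k := by exact_mod_cast hk
  exact_mod_cast this.le

theorem tendsto_pow_zero_of_spectralRadius_lt_one {a : 𝒜} (ha : spectralRadius ℂ a < 1) :
    Tendsto (fun k : ℕ => a ^ k) atTop (𝓝 0) := by
  obtain ⟨r, h0, h1, h⟩ := exists_eventually_norm_pow_le_of_spectralRadius_lt_one ha
  exact squeeze_zero_norm' h (tendsto_pow_atTop_nhds_zero_of_lt_one h0 h1)

theorem spectralRadius_lt_one_of_norm_pow_lt_one [NormOneClass 𝒜] {a : 𝒜} {k : ℕ} (hk : k ≠ 0)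
    (h : ‖a ^ k‖ < 1) : spectralRadius ℂ a < 1 := by
  have h1 := (spectrum.spectralRadius_pow_le (𝕜 := ℂ) a k hk).trans
    (spectrum.spectralRadius_le_nnnorm (𝕜 := ℂ) (a ^ k))
  have h2 : (‖a ^ k‖₊ : ENNReal) < 1 := by exact_mod_cast h
  by_contra hc
  exact absurd (one_le_pow_of_one_le' (not_lt.1 hc) k) (not_le.2 (h1.trans_lt h2))

theorem isOpen_setOf_spectralRadius_lt_one [NormOneClass 𝒜] :
    IsOpen {a : 𝒜 | spectralRadius ℂ a < 1} := by
  rw [isOpen_iff_mem_nhds]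
  intro a ha
  have h := (tendsto_pow_zero_of_spectralRadius_lt_one ha).norm
  rw [norm_zero] at h
  obtain ⟨k, hk, hk0⟩ := ((h.eventually_lt_const one_pos).and (eventually_gt_atTop 0)).exists
  have hc : ContinuousAt (fun b : 𝒜 => ‖b ^ k‖) a := by fun_prop
  filter_upwards [hc.eventually_lt_const hk] with b hb
  exact spectralRadius_lt_one_of_norm_pow_lt_one hk0.ne' hb

end SpectralRadius

/-! ### Schur matrices and the Lyapunov criterion -/

section Schur

attribute [local instance] Matrix.linftyOpNormedAddCommGroup Matrix.linftyOpNormedSpace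
  Matrix.linftyOpNormedRing Matrix.linftyOpNormedAlgebra

variable {n : ℕ}

theorem isSchur_of_subsingleton (M : Matrix (Fin 0) (Fin 0) ℝ) : IsSchur M := by
  simp [IsSchur]

theorem isOpen_setOf_isSchur : IsOpen {M : Matrix (Fin n) (Fin n) ℝ | IsSchur M} := by
  -- In size zero the matrix ring is trivial and `‖1‖ = 1` fails.
  rcases n with _ | n
  · simp [isSchur_of_subsingleton]
  · exact (isOpen_setOf_spectralRadius_lt_one (𝒜 := Matrix (Fin (n + 1)) (Fin (n + 1)) ℂ)).preimage
      (f := fun M : Matrix (Fin (n + 1)) (Fin (n + 1)) ℝ => M.map (fun x : ℝ => (x : ℂ)))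
      (continuous_id.matrix_map Complex.continuous_ofReal)

theorem IsSchur.tendsto_pow {M : Matrix (Fin n) (Fin n) ℝ} (hM : IsSchur M) :
    Tendsto (fun k : ℕ => M ^ k) atTop (𝓝 0) := by
  have h := tendsto_pow_zero_of_spectralRadius_lt_one hM
  have h2 := ((continuous_id.matrix_map Complex.continuous_re).tendsto
    (0 : Matrix (Fin n) (Fin n) ℂ)).comp h
  refine (h2.congr fun k => ?_).trans_eq ?_
  · have := Matrix.map_pow M Complex.ofRealHom k
    ext i j
    exact (congrArg Complex.re (congrFun (congrFun this i) j)).symm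
  · congr 1

theorem IsSchur.of_sq_eq_zero {M : Matrix (Fin n) (Fin n) ℝ} (hM : M * M = 0) : IsSchur M := by
  rcases n with _ | n
  · exact isSchur_of_subsingleton M
  · refine spectralRadius_lt_one_of_norm_pow_lt_one (k := 2) two_ne_zero ?_
    have := Matrix.map_mul (L := M) (M := M) (f := Complex.ofRealHom)
    rw [hM] at this
    rw [pow_two]
    change ‖M.map Complex.ofRealHom * M.map Complex.ofRealHom‖ < 1
    rw [← this]
    simp

theorem not_isSchur_of_mulVec_eq {M : Matrix (Fin n) (Fin n) ℝ} {v : Fin n → ℝ} (hv : v ≠ 0)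
    (h : M *ᵥ v = v) : ¬ IsSchur M := by
  intro hM
  have hk : ∀ k : ℕ, M ^ k *ᵥ v = v := by
    intro k
    induction k with
    | zero => simp
    | succ k ih => rw [pow_succ, ← mulVec_mulVec, h, ih]
  have h1 : Tendsto (fun k : ℕ => M ^ k *ᵥ v) atTop (𝓝 (0 *ᵥ v)) :=
    ((continuous_id.matrix_mulVec continuous_const).tendsto _).comp hM.tendsto_pow
  simp only [hk, zero_mulVec] at h1
  exact hv (tendsto_nhds_unique tendsto_const_nhds h1)

/-- A strict discrete Lyapunov inequality certifies the Schur property. -/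
theorem isSchur_of_lyapunov {M P : Matrix (Fin n) (Fin n) ℝ}
    (hP : ∀ x, x ≠ 0 → 0 < x ⬝ᵥ P *ᵥ x)
    (h : ∀ x, x ≠ 0 → (x ᵥ* M) ⬝ᵥ P *ᵥ (x ᵥ* M) < x ⬝ᵥ P *ᵥ x) : IsSchur M := by
  rcases n with _ | n
  · exact isSchur_of_subsingleton M
  refine spectrum.spectralRadius_lt_of_forall_lt (r := 1) _ fun z hz => ?_
  have hz' : ¬ IsUnit (algebraMap ℂ (Matrix (Fin (n + 1)) (Fin (n + 1)) ℂ) z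
      - M.map (fun x : ℝ => (x : ℂ))) := spectrum.mem_iff.1 hz
  rw [Matrix.isUnit_iff_isUnit_det, isUnit_iff_ne_zero, not_not,
    ← Matrix.exists_vecMul_eq_zero_iff] at hz'
  obtain ⟨v, hv, hvz⟩ := hz'
  rw [vecMul_sub, Algebra.algebraMap_eq_smul_one, vecMul_smul, vecMul_one, sub_eq_zero] at hvz
  set x : Fin (n + 1) → ℝ := fun i => (v i).re with hx
  set y : Fin (n + 1) → ℝ := fun i => (v i).im with hy
  have hu : x ᵥ* M = z.re • x - z.im • y := by
    ext i
    have := congrArg Complex.re (congrFun hvz i)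
    simpa [vecMul, dotProduct, hx, hy] using this.symm
  have hw : y ᵥ* M = z.im • x + z.re • y := by
    ext i
    have := congrArg Complex.im (congrFun hvz i)
    simp [vecMul, dotProduct] at this
    simp [vecMul, dotProduct, hx, hy]
    linarith
  have hxy : x ≠ 0 ∨ y ≠ 0 := by
    by_contra! hc
    exact hv (funext fun i => Complex.ext (congrFun hc.1 i) (congrFun hc.2 i))
  -- On the real and imaginary parts of a left eigenvector, `M` acts as a rotation scaled by `‖z‖`;
  -- the cross terms cancel even for nonsymmetric `P`.
  have key : (x ᵥ* M) ⬝ᵥ P *ᵥ (x ᵥ* M) + (y ᵥ* M) ⬝ᵥ P *ᵥ (y ᵥ* M)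
      = (z.re ^ 2 + z.im ^ 2) * (x ⬝ᵥ P *ᵥ x + y ⬝ᵥ P *ᵥ y) := by
    rw [hu, hw]
    simp only [mulVec_add, mulVec_sub, mulVec_smul, dotProduct_add, dotProduct_sub, add_dotProduct,
      sub_dotProduct, smul_dotProduct, dotProduct_smul, smul_eq_mul]
    ring
  have hP' : ∀ x, 0 ≤ x ⬝ᵥ P *ᵥ x := fun x => by
    by_cases h0 : x = 0
    · simp [h0]
    · exact (hP x h0).le
  have h' : ∀ x, (x ᵥ* M) ⬝ᵥ P *ᵥ (x ᵥ* M) ≤ x ⬝ᵥ P *ᵥ x := fun x => by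
    by_cases h0 : x = 0
    · simp [h0]
    · exact (h x h0).le
  have hlt : (z.re ^ 2 + z.im ^ 2) * (x ⬝ᵥ P *ᵥ x + y ⬝ᵥ P *ᵥ y)
      < x ⬝ᵥ P *ᵥ x + y ⬝ᵥ P *ᵥ y := by
    rw [← key]
    rcases hxy with h0 | h0
    · linarith [h x h0, h' y]
    · linarith [h y h0, h' x]
  have hpos : 0 ≤ x ⬝ᵥ P *ᵥ x + y ⬝ᵥ P *ᵥ y := add_nonneg (hP' x) (hP' y)
  have hz1 : z.re ^ 2 + z.im ^ 2 < 1 := by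
    by_contra! hc
    nlinarith
  have hnorm : ‖z‖ ^ 2 < 1 := by
    rw [Complex.sq_norm, Complex.normSq_apply]
    linarith
  have : ‖z‖ < 1 := by
    have := norm_nonneg z
    nlinarith
  exact_mod_cast this

end Schur

/-! ### The Stein equation -/

section Stein

variable {n : ℕ}

/-- The solution `P` of the Stein equation `P - M P Mᵀ = 1`, computed by vectorization. -/
noncomputable def steinSolution (M : Matrix (Fin n) (Fin n) ℝ) : Matrix (Fin n) (Fin n) ℝ :=
  -- `vec` stacks columns, so its index is (column, row).
  Matrix.of fun i j => ((1 - M ⊗ₖ M)⁻¹ *ᵥ vec (1 : Matrix (Fin n) (Fin n) ℝ)) (j, i)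

theorem vec_steinSolution (M : Matrix (Fin n) (Fin n) ℝ) :
    vec (steinSolution M) = (1 - M ⊗ₖ M)⁻¹ *ᵥ vec (1 : Matrix (Fin n) (Fin n) ℝ) := rfl

theorem one_sub_kronecker_mulVec_vec (M X : Matrix (Fin n) (Fin n) ℝ) :
    (1 - M ⊗ₖ M) *ᵥ vec X = vec (X - M * X * Mᵀ) := by
  rw [sub_mulVec, one_mulVec, kronecker_mulVec_vec, vec_sub]

theorem eq_pow_mul_mul_pow {M X : Matrix (Fin n) (Fin n) ℝ} (h : X = M * X * Mᵀ) (k : ℕ) :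
    X = M ^ k * X * (M ^ k)ᵀ := by
  induction k with
  | zero => simp
  | succ k ih =>
    rw [pow_succ, transpose_mul]
    calc X = M ^ k * X * (M ^ k)ᵀ := ih
      _ = M ^ k * (M * X * Mᵀ) * (M ^ k)ᵀ := by rw [← h]
      _ = _ := by simp only [Matrix.mul_assoc]

theorem IsSchur.tendsto_pow_mul_mul_pow {M : Matrix (Fin n) (Fin n) ℝ} (hM : IsSchur M)
    (X : Matrix (Fin n) (Fin n) ℝ) :
    Tendsto (fun k : ℕ => M ^ k * X * (M ^ k)ᵀ) atTop (𝓝 0) := by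
  have hc : Continuous fun N : Matrix (Fin n) (Fin n) ℝ => N * X * Nᵀ := by fun_prop
  have h := (hc.tendsto 0).comp hM.tendsto_pow
  rwa [Matrix.zero_mul, Matrix.zero_mul] at h

theorem IsSchur.eq_zero_of_stein {M X : Matrix (Fin n) (Fin n) ℝ} (hM : IsSchur M)
    (h : X - M * X * Mᵀ = 0) : X = 0 := by
  have h1 := hM.tendsto_pow_mul_mul_pow X
  simp only [← eq_pow_mul_mul_pow (sub_eq_zero.1 h)] at h1
  exact tendsto_nhds_unique tendsto_const_nhds h1

/-- A kernel vector is `vec X` with `X = M X Mᵀ`; iterating gives `X = Mᵏ X (Mᵏ)ᵀ → 0`. -/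
theorem IsSchur.det_one_sub_kronecker_ne_zero {M : Matrix (Fin n) (Fin n) ℝ} (hM : IsSchur M) :
    (1 - M ⊗ₖ M).det ≠ 0 := by
  intro h
  obtain ⟨w, hw, hw0⟩ := Matrix.exists_mulVec_eq_zero_iff.2 h
  have hX : w = vec (Matrix.of fun i j => w (j, i)) := rfl
  rw [hX, one_sub_kronecker_mulVec_vec, vec_eq_zero_iff] at hw0
  apply hw
  rw [hX, hM.eq_zero_of_stein hw0, vec_zero]

theorem IsSchur.steinSolution_eq {M : Matrix (Fin n) (Fin n) ℝ} (hM : IsSchur M) :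
    steinSolution M - M * steinSolution M * Mᵀ = 1 := by
  rw [← vec_inj]
  rw [← one_sub_kronecker_mulVec_vec, vec_steinSolution, mulVec_mulVec,
    mul_nonsing_inv _ (isUnit_iff_ne_zero.2 hM.det_one_sub_kronecker_ne_zero), one_mulVec]

/-- The transpose solves the same equation, whose solution is unique. -/
theorem IsSchur.isSymm_steinSolution {M : Matrix (Fin n) (Fin n) ℝ} (hM : IsSchur M) :
    (steinSolution M).IsSymm := by
  have h := hM.steinSolution_eq
  have ht := congrArg transpose h
  simp only [transpose_sub, transpose_mul, transpose_transpose, transpose_one,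
    ← Matrix.mul_assoc] at ht
  refine sub_eq_zero.1 (hM.eq_zero_of_stein ?_)
  rw [Matrix.mul_sub, Matrix.sub_mul, sub_sub_sub_comm, ht, h, sub_self]

theorem dotProduct_mul_mul_transpose_mulVec (N X : Matrix (Fin n) (Fin n) ℝ) (x : Fin n → ℝ) :
    x ⬝ᵥ (N * X * Nᵀ) *ᵥ x = (x ᵥ* N) ⬝ᵥ X *ᵥ (x ᵥ* N) := by
  rw [← mulVec_mulVec, ← mulVec_mulVec, dotProduct_mulVec, mulVec_transpose]

theorem IsSchur.stein_form {M : Matrix (Fin n) (Fin n) ℝ} (hM : IsSchur M) (x : Fin n → ℝ) :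
    x ⬝ᵥ steinSolution M *ᵥ x
      = x ⬝ᵥ x + (x ᵥ* M) ⬝ᵥ steinSolution M *ᵥ (x ᵥ* M) := by
  have := congrArg (fun N => x ⬝ᵥ N *ᵥ x) hM.steinSolution_eq
  simp only [sub_mulVec, dotProduct_sub, one_mulVec, dotProduct_mul_mul_transpose_mulVec] at this
  linarith

/-- Along the orbit `x Mᵏ` the quadratic form is nonincreasing and tends to zero. -/
theorem IsSchur.steinSolution_nonneg {M : Matrix (Fin n) (Fin n) ℝ} (hM : IsSchur M)
    (x : Fin n → ℝ) : 0 ≤ x ⬝ᵥ steinSolution M *ᵥ x := by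
  have hk : ∀ k : ℕ, x ⬝ᵥ (M ^ k * steinSolution M * (M ^ k)ᵀ) *ᵥ x
      ≤ x ⬝ᵥ steinSolution M *ᵥ x := by
    intro k
    rw [dotProduct_mul_mul_transpose_mulVec]
    induction k with
    | zero => simp
    | succ k ih =>
      have h1 := hM.stein_form (x ᵥ* M ^ k)
      rw [vecMul_vecMul, ← pow_succ] at h1
      have h2 : 0 ≤ (x ᵥ* M ^ k) ⬝ᵥ (x ᵥ* M ^ k) := by
        simpa using dotProduct_star_self_nonneg (x ᵥ* M ^ k)
      linarith
  have hc : Continuous fun N : Matrix (Fin n) (Fin n) ℝ => x ⬝ᵥ N *ᵥ x := by fun_prop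
  have ht := (hc.tendsto 0).comp (hM.tendsto_pow_mul_mul_pow (steinSolution M))
  simpa using le_of_tendsto' ht hk

theorem IsSchur.steinSolution_pos {M : Matrix (Fin n) (Fin n) ℝ} (hM : IsSchur M)
    {x : Fin n → ℝ} (hx : x ≠ 0) : 0 < x ⬝ᵥ steinSolution M *ᵥ x := by
  have h1 : 0 < x ⬝ᵥ x := by simpa using dotProduct_star_self_pos_iff.2 hx
  linarith [hM.stein_form x, hM.steinSolution_nonneg (x ᵥ* M)]

/-- The explicit inverse in `steinSolution` reduces this to continuity of matrix inversion where the
determinant is nonzero. -/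
theorem continuousOn_steinSolution :
    ContinuousOn (steinSolution (n := n)) {M | IsSchur M} := by
  intro M hM
  apply ContinuousAt.continuousWithinAt
  have hdet := IsSchur.det_one_sub_kronecker_ne_zero hM
  have h1 : ContinuousAt (fun N : Matrix (Fin n) (Fin n) ℝ => 1 - N ⊗ₖ N) M := by
    refine Continuous.continuousAt (continuous_const.sub (continuous_matrix fun i j => ?_))
    simp only [kroneckerMap_apply]
    fun_prop
  have h2 : ContinuousAt (fun N : Matrix (Fin n) (Fin n) ℝ => (1 - N ⊗ₖ N)⁻¹) M :=
    ContinuousAt.comp (g := Inv.inv) (continuousAt_matrix_inv _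
      (by simpa [Ring.inverse_eq_inv'] using continuousAt_inv₀ hdet)) h1
  have h3 : Continuous fun N : Matrix (Fin n × Fin n) (Fin n × Fin n) ℝ =>
      (Matrix.of fun i j => (N *ᵥ vec (1 : Matrix (Fin n) (Fin n) ℝ)) (j, i) :
        Matrix (Fin n) (Fin n) ℝ) := by
    refine continuous_matrix fun i j => ?_
    simp only [of_apply]
    fun_prop
  exact ContinuousAt.comp (g := fun N : Matrix (Fin n × Fin n) (Fin n × Fin n) ℝ =>
      (Matrix.of fun i j => (N *ᵥ vec (1 : Matrix (Fin n) (Fin n) ℝ)) (j, i) :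
        Matrix (Fin n) (Fin n) ℝ)) h3.continuousAt h2

end Stein

/-! ### Convex parametrization of the stabilizing gains -/

section Parametrization

variable {n m₁ m₂ : ℕ} (A : Matrix (Fin n) (Fin n) ℝ)
  (B₁ : Matrix (Fin n) (Fin m₁) ℝ) (B₂ : Matrix (Fin n) (Fin m₂) ℝ)

/-- The linear matrix inequality obtained from the Lyapunov inequality for `A - B₁ K - B₂ L`
by the substitution `Y₁ = K P`, `Y₂ = L P`. -/
def lyapunovLMI : Set (Matrix (Fin n) (Fin n) ℝ ×
    Matrix (Fin m₁) (Fin n) ℝ × Matrix (Fin m₂) (Fin n) ℝ) :=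
  -- This is the form of the block matrix `[[P, N], [Nᵀ, P]]` with `N = A P - B₁ Y₁ - B₂ Y₂`, linear
  -- in the unknowns. If `N = M P`, its Schur complement is `P - M P Mᵀ`.
  {q | q.1.IsSymm ∧ ∀ x y : Fin n → ℝ, (x ≠ 0 ∨ y ≠ 0) →
    0 < x ⬝ᵥ q.1 *ᵥ x + 2 * (x ⬝ᵥ (A * q.1 - B₁ * q.2.1 - B₂ * q.2.2) *ᵥ y) + y ⬝ᵥ q.1 *ᵥ y}

theorem convex_lyapunovLMI : Convex ℝ (lyapunovLMI A B₁ B₂) := by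
  rintro ⟨P, Y⟩ ⟨hP, h⟩ ⟨P', Y'⟩ ⟨hP', h'⟩ a b ha hb hab
  refine ⟨(hP.smul a).add (hP'.smul b), fun x y hxy => ?_⟩
  have h1 := h x y hxy
  have h2 := h' x y hxy
  simp only [Prod.fst_add, Prod.snd_add, Prod.smul_fst, Prod.smul_snd, Matrix.mul_add,
    Matrix.mul_smul, add_mulVec, sub_mulVec, smul_mulVec, dotProduct_add, dotProduct_sub,
    dotProduct_smul, smul_eq_mul] at h1 h2 ⊢
  rcases ha.eq_or_lt with rfl | ha
  · obtain rfl : b = 1 := by linarith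
    linarith
  · have := mul_pos ha h1
    have := mul_nonneg hb h2.le
    linarith

variable {A B₁ B₂}

theorem pos_of_mem_lyapunovLMI {q} (hq : q ∈ lyapunovLMI A B₁ B₂) (x : Fin n → ℝ) (hx : x ≠ 0) :
    0 < x ⬝ᵥ q.1 *ᵥ x := by
  simpa using hq.2 x 0 (Or.inl hx)

theorem det_ne_zero_of_mem_lyapunovLMI {q} (hq : q ∈ lyapunovLMI A B₁ B₂) : q.1.det ≠ 0 := by
  intro h
  obtain ⟨x, hx, hx0⟩ := Matrix.exists_mulVec_eq_zero_iff.2 h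
  have := pos_of_mem_lyapunovLMI hq x hx
  simp [hx0] at this

theorem recover_mem_stabilizingPairs {q} (hq : q ∈ lyapunovLMI A B₁ B₂) :
    (q.2.1 * q.1⁻¹, q.2.2 * q.1⁻¹) ∈ stabilizingPairs A B₁ B₂ := by
  have hdet := isUnit_iff_ne_zero.2 (det_ne_zero_of_mem_lyapunovLMI hq)
  set M := A - B₁ * (q.2.1 * q.1⁻¹) - B₂ * (q.2.2 * q.1⁻¹) with hM
  have hMP : A * q.1 - B₁ * q.2.1 - B₂ * q.2.2 = M * q.1 := by
    rw [hM, Matrix.sub_mul, Matrix.sub_mul, Matrix.mul_assoc B₁, Matrix.mul_assoc B₂,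
      nonsing_inv_mul_cancel_right _ _ hdet, nonsing_inv_mul_cancel_right _ _ hdet]
  refine isSchur_of_lyapunov (M := M) (pos_of_mem_lyapunovLMI hq) fun x hx => ?_
  -- This `y` minimizes the form for fixed `x`, leaving the Lyapunov inequality.
  have h := hq.2 x (-(x ᵥ* M)) (Or.inl hx)
  rw [hMP, ← mulVec_mulVec, dotProduct_mulVec x M] at h
  simp only [mulVec_neg, dotProduct_neg, neg_dotProduct] at h
  linarith

theorem lift_mem_lyapunovLMI {p} (hp : p ∈ stabilizingPairs A B₁ B₂) :
    (steinSolution (A - B₁ * p.1 - B₂ * p.2), p.1 * steinSolution (A - B₁ * p.1 - B₂ * p.2),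
      p.2 * steinSolution (A - B₁ * p.1 - B₂ * p.2)) ∈ lyapunovLMI A B₁ B₂ := by
  set M := A - B₁ * p.1 - B₂ * p.2 with hM
  have hS : IsSchur M := hp
  set P := steinSolution M with hP
  have hsymm : P.IsSymm := hS.isSymm_steinSolution
  have hMP : A * P - B₁ * (p.1 * P) - B₂ * (p.2 * P) = M * P := by
    rw [hM, Matrix.sub_mul, Matrix.sub_mul, Matrix.mul_assoc, Matrix.mul_assoc]
  refine ⟨hsymm, fun x y hxy => ?_⟩
  simp only
  rw [hMP, ← mulVec_mulVec, dotProduct_mulVec x M, hS.stein_form x, ← hP]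
  set u := x ᵥ* M
  have hcomm : y ⬝ᵥ P *ᵥ u = u ⬝ᵥ P *ᵥ y := by
    rw [dotProduct_comm, dotProduct_mulVec, ← mulVec_transpose, hsymm.eq]
  have hsq : (u + y) ⬝ᵥ P *ᵥ (u + y) = u ⬝ᵥ P *ᵥ u + 2 * (u ⬝ᵥ P *ᵥ y) + y ⬝ᵥ P *ᵥ y := by
    rw [mulVec_add, add_dotProduct, dotProduct_add, dotProduct_add, hcomm]
    ring
  -- By the Stein equation, the form of the matrix inequality equals this completed square.
  have hpos : 0 < x ⬝ᵥ x + (u + y) ⬝ᵥ P *ᵥ (u + y) := by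
    by_cases hx : x = 0
    · have hy : u + y ≠ 0 := by
        rcases hxy with h | h
        · exact absurd hx h
        · simpa [u, hx] using h
      simpa [hx] using hS.steinSolution_pos hy
    · have h1 : 0 < x ⬝ᵥ x := by simpa using dotProduct_star_self_pos_iff.2 hx
      linarith [hS.steinSolution_nonneg (u + y)]
  linarith

/-! ### Retraction onto the stabilizing gains -/

variable (A B₁ B₂)

/-- The gains `(Y₁ P⁻¹, Y₂ P⁻¹)` recovered from a solution of the matrix inequality. -/
noncomputable def recoverGains : C(lyapunovLMI A B₁ B₂, stabilizingPairs A B₁ B₂) where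
  toFun q := ⟨_, recover_mem_stabilizingPairs q.2⟩
  continuous_toFun := by
    have hinv : Continuous fun q : lyapunovLMI A B₁ B₂ => q.1.1⁻¹ := by
      rw [continuous_iff_continuousAt]
      intro q
      have hdet := det_ne_zero_of_mem_lyapunovLMI q.2
      exact ContinuousAt.comp (g := Inv.inv) (f := fun q : lyapunovLMI A B₁ B₂ => q.1.1)
        (continuousAt_matrix_inv _ (by simpa [Ring.inverse_eq_inv'] using continuousAt_inv₀ hdet))
        (by fun_prop)
    refine Continuous.subtype_mk (Continuous.prodMk ?_ ?_) _ <;> fun_prop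

/-- Stabilizing gains lift to the matrix inequality through the Stein equation. -/
noncomputable def liftGains : C(stabilizingPairs A B₁ B₂, lyapunovLMI A B₁ B₂) where
  toFun p := ⟨_, lift_mem_lyapunovLMI p.2⟩
  continuous_toFun := by
    have hP : Continuous fun p : stabilizingPairs A B₁ B₂ =>
        steinSolution (A - B₁ * p.1.1 - B₂ * p.1.2) :=
      continuousOn_steinSolution.comp_continuous (by fun_prop) fun p => p.2
    refine Continuous.subtype_mk (hP.prodMk (Continuous.prodMk ?_ ?_)) _ <;> fun_prop

theorem recoverGains_comp_liftGains :
    (recoverGains A B₁ B₂).comp (liftGains A B₁ B₂) = ContinuousMap.id _ := by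
  ext1 p
  have hdet := isUnit_iff_ne_zero.2 (det_ne_zero_of_mem_lyapunovLMI (lift_mem_lyapunovLMI p.2))
  refine Subtype.ext (Prod.ext ?_ ?_) <;>
    exact mul_nonsing_inv_cancel_right _ _ hdet

/-- The identity of `Y` factors through `X`, whose identity is nullhomotopic. -/
theorem contractibleSpace_of_retract {X Y : Type*} [TopologicalSpace X] [TopologicalSpace Y]
    [ContractibleSpace X] {r : C(X, Y)} {s : C(Y, X)} (h : r.comp s = ContinuousMap.id Y) :
    ContractibleSpace Y := by
  rw [contractible_iff_id_nullhomotopic, ← h]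
  exact (((contractible_iff_id_nullhomotopic X).1 inferInstance).comp_right r).comp_left s

theorem contractibleSpace_stabilizingPairs (h : (stabilizingPairs A B₁ B₂).Nonempty) :
    ContractibleSpace (stabilizingPairs A B₁ B₂) := by
  obtain ⟨p, hp⟩ := h
  have := (convex_lyapunovLMI A B₁ B₂).contractibleSpace ⟨_, lift_mem_lyapunovLMI hp⟩
  exact contractibleSpace_of_retract (recoverGains_comp_liftGains A B₁ B₂)

theorem isOpen_stabilizingPairs : IsOpen (stabilizingPairs A B₁ B₂) :=
  isOpen_setOf_isSchur.preimage
    (f := fun p : Matrix (Fin m₁) (Fin n) ℝ × Matrix (Fin m₂) (Fin n) ℝ => A - B₁ * p.1 - B₂ * p.2) (by fun_prop)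

variable {A B₁ B₂}

theorem IsStabilizable.nonempty_stabilizingPairs (h : IsStabilizable A (fromCols B₁ B₂)) :
    (stabilizingPairs A B₁ B₂).Nonempty := by
  obtain ⟨F, hF⟩ := h
  refine ⟨(F.toRows₁, F.toRows₂), ?_⟩
  rw [← fromRows_toRows F, fromCols_mul_fromRows, ← sub_sub] at hF
  exact hF

end Parametrization

/-- With `A = 0` and input columns `e₀`, `e₁`, the nilpotent closed loops `2 e₀ e₁ᵀ` and
`2 e₁ e₀ᵀ` have a midpoint with eigenvalue `1`. -/
theorem exists_stabilizable_not_convex {n m₁ m₂ : ℕ} (hn : 2 ≤ n) (h₁ : 1 ≤ m₁) (h₂ : 1 ≤ m₂) :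
    ∃ (A : Matrix (Fin n) (Fin n) ℝ)
      (B₁ : Matrix (Fin n) (Fin m₁) ℝ) (B₂ : Matrix (Fin n) (Fin m₂) ℝ),
      IsStabilizable A (fromCols B₁ B₂) ∧ ¬ Convex ℝ (stabilizingPairs A B₁ B₂) := by
  let i : Fin n := ⟨0, by omega⟩
  let j : Fin n := ⟨1, by omega⟩
  have hij : i ≠ j := by simp [i, j]
  let k₁ : Fin m₁ := ⟨0, h₁⟩
  let k₂ : Fin m₂ := ⟨0, h₂⟩
  refine ⟨0, single i k₁ 1, single j k₂ 1, ⟨0, ?_⟩, fun hconv => ?_⟩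
  · exact IsSchur.of_sq_eq_zero (by simp)
  -- The negative sign offsets the minus in `A - B₁ K - B₂ L`.
  have hp : (single k₁ j (-2 : ℝ), (0 : Matrix (Fin m₂) (Fin n) ℝ)) ∈
      stabilizingPairs (0 : Matrix (Fin n) (Fin n) ℝ) (single i k₁ 1) (single j k₂ 1) := by
    refine IsSchur.of_sq_eq_zero ?_
    simp [single_mul_single_of_ne, hij.symm]
  have hq : ((0 : Matrix (Fin m₁) (Fin n) ℝ), single k₂ i (-2 : ℝ)) ∈
      stabilizingPairs (0 : Matrix (Fin n) (Fin n) ℝ) (single i k₁ 1) (single j k₂ 1) := by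
    refine IsSchur.of_sq_eq_zero ?_
    simp [single_mul_single_of_ne, hij]
  have hmid := hconv hp hq (a := 1 / 2) (b := 1 / 2) (by norm_num) (by norm_num) (by norm_num)
  -- The midpoint loop `e₀ e₁ᵀ + e₁ e₀ᵀ` swaps `e₀` and `e₁`, hence fixes their sum.
  refine not_isSchur_of_mulVec_eq (v := Pi.single i 1 + Pi.single j 1) ?_ ?_ hmid
  · intro h
    simpa [hij] using congrFun h i
  · suffices (-single i j (-1 : ℝ) - single j i (-1)) *ᵥ (Pi.single i 1 + Pi.single j 1)
        = Pi.single i 1 + Pi.single j 1 by simpa using this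
    ext l
    by_cases hi : l = i
    · simp [mulVec_add, hi, hij, hij.symm]
    · by_cases hj : l = j
      · simp [mulVec_add, hj, hij, hij.symm]
      · simp [mulVec_add, hi, hj, Ne.symm hi, Ne.symm hj]


theorem mainTheorem7 :
    (∀ (n m₁ m₂ : ℕ) (A : Matrix (Fin n) (Fin n) ℝ)
        (B₁ : Matrix (Fin n) (Fin m₁) ℝ) (B₂ : Matrix (Fin n) (Fin m₂) ℝ),
      IsOpen (stabilizingPairs A B₁ B₂) ∧
      (IsStabilizable A (Matrix.fromCols B₁ B₂) →
        ContractibleSpace (stabilizingPairs A B₁ B₂) ∧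
        IsPathConnected (stabilizingPairs A B₁ B₂) ∧
        SimplyConnectedSpace (stabilizingPairs A B₁ B₂))) ∧
    (∀ n m₁ m₂ : ℕ, 2 ≤ n → 1 ≤ m₁ → 1 ≤ m₂ →
      ∃ (A : Matrix (Fin n) (Fin n) ℝ)
        (B₁ : Matrix (Fin n) (Fin m₁) ℝ) (B₂ : Matrix (Fin n) (Fin m₂) ℝ),
        IsStabilizable A (Matrix.fromCols B₁ B₂) ∧
        ¬ Convex ℝ (stabilizingPairs A B₁ B₂)) := by
  refine ⟨fun n m₁ m₂ A B₁ B₂ => ⟨isOpen_stabilizingPairs A B₁ B₂, fun h => ?_⟩,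
    fun n m₁ m₂ hn h₁ h₂ => exists_stabilizable_not_convex hn h₁ h₂⟩
  have := contractibleSpace_stabilizingPairs A B₁ B₂ h.nonempty_stabilizingPairs
  exact ⟨this, isPathConnected_iff_pathConnectedSpace.2 inferInstance, inferInstance⟩
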